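/- Let $\{p_j\}_{j\ge1}$ and $\{\alpha_j\}_{j\ge1}$ be sequences of positive real numbers such that (a) $\sum_j p_j<\infty$ and $\sum_j\alpha_j<\infty$; (b) there are $0<m<M<\infty$ with $p_{j+1}/p_j\in(m,M)$ for all $j$; (c) $\sup_j\alpha_j/p_j<\infty$. Let $\eta\ge0$ be an integer and let $\hat b=(\hat b_{ij})_{i,j\ge1}$ be a real matrix that is $\eta$-banded ($\hat b_{ij}=0$ whenever $|i-j|>\eta$) and satisfies (d) $|\hat b_{ij}|\le\alpha_i$ for all $i,j$; (e) $\hat b_{ij}=\hat b_{ji}$ for all $i,j$. Put $b=(\delta_{ij}+\hat b_{ij})_{i,j\ge1}$, and for $x\in\mathbb R^\infty$ (the space of all real sequences) let $(bx)_i=\sum_j b_{ij}x_j$, a finite sum. Let $\mu_G$ be the gaussian measure on $\mathbb R^\infty$, i.e. the countable product of standard gaussian measures on $\mathbb R$. Then: (1) The formula $(\hat Bx)_i=\sum_j\hat b_{ij}x_j$ defines a bounded operator $\hat B$ on the complex Hilbert space $\ell^2(\mathbb N)$, and $\hat B$ is of trace class, i.e. $\sum_i\langle|\hat B|e_i,e_i\rangle<\infty$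 for an orthonormal basis $\{e_i\}$, where $|\hat B|=(\hat B^*\hat B)^{1/2}$. (2) The Fredholm determinant $\det b=\det(I+\hat B)=\prod_j(1+\lambda_j)$, where $\lambda_j$ runs over the nonzero eigenvalues of $\hat B$ repeated according to algebraic multiplicity, is well defined (the multiplicities are finite, $\sum_j|\lambda_j|<\infty$, and the product converges); moreover, $\det b\ne0$ if and only if $I+\hat B$ is invertible as a bounded operator on $\ell^2(\mathbb N)$. (3) There is $C>0$ such that for every $x\in\mathbb R^\infty$ with $\sum_jx_j^2p_j<\infty$ the series $\sum_j\bigl(x_j^2-(bx)_j^2\bigr)$ converges absolutely and $$\Bigl|\sum_{j=1}^\infty\bigl(x_j^2-(bx)_j^2\bigr)\Bigr|\le C\sum_{j=1}^\infty x_j^2p_j .$$ (4) If $\det b\ne0$, then the transformation $B\colon\mathbb R^\infty\to\mathbb R^\infty$, $Bx=bx$, is invertible up to $\mu_G$-null sets: it is Borel measurable and there are Borel sets $D,E\subseteq\mathbb R^\infty$ of full measure $\mu_G$ such that $B$ restricts to a bijection of $D$ onto $E$ whose inverse $E\to D$ is Borel measurable. -/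

import Mathlib

open MeasureTheory ProbabilityTheory Filter Topology

noncomputable section

universe u

/-- A matrix indexed by `ℕ × ℕ` is `η`-banded if its entries vanish at distance more than `η`
from the diagonal. -/
def IsBanded (η : ℕ) (a : ℕ → ℕ → ℝ) : Prop :=
  ∀ i j : ℕ, (η : ℤ) < |(i : ℤ) - (j : ℤ)| → a i j = 0

/-- The matrix `(δ_{ij} + a_{ij})`. -/
def onePlus (a : ℕ → ℕ → ℝ) (i j : ℕ) : ℝ :=
  (if i = j then 1 else 0) + a i j

/-- The complex Hilbert space `ℓ²` of square-summable sequences. -/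
abbrev EllTwo : Type := lp (fun _ : ℕ => ℂ) 2

/-- The bounded operator `T` on `ℓ²` is induced by the real matrix `a`:
`(T x)_i = ∑_j a_{ij} x_j`. -/
def InducesOperator (a : ℕ → ℕ → ℝ) (T : EllTwo →L[ℂ] EllTwo) : Prop :=
  ∀ (x : EllTwo) (i : ℕ), HasSum (fun j => (a i j : ℂ) * x j) (T x i)

section Hilbert

variable {H : Type u} [NormedAddCommGroup H] [InnerProductSpace ℂ H] [CompleteSpace H]

/-- `T` is of trace class: with `|T| = (T* T)^{1/2}`, the series `∑ ⟨|T| e_i, e_i⟩` (which has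
nonnegative terms) converges for an orthonormal basis `(e_i)` of `H`. -/
def IsTraceClass (T : H →L[ℂ] H) : Prop :=
  ∃ (ι : Type u) (e : HilbertBasis ι ℂ H),
    Summable fun i => ‖inner ℂ (CFC.abs T (e i)) (e i)‖

/-- The generalized eigenspace (root space) `⋃_k ker (T - μ)^k`. -/
def rootSpace (T : H →L[ℂ] H) (μ : ℂ) : Submodule ℂ H :=
  Module.End.maxGenEigenspace (T : H →ₗ[ℂ] H) μ

/-- The algebraic multiplicity of `μ` as an eigenvalue of `T` (zero if `μ` is not an
eigenvalue). -/
def algMult (T : H →L[ℂ] H) (μ : ℂ) : ℕ :=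
  Module.finrank ℂ (rootSpace T μ)

/-- The Fredholm determinant `det (I + T) = ∏ (1 + λ_j)`, where the `λ_j` are the eigenvalues of
`T` repeated according to algebraic multiplicity (the eigenvalue `0` contributes the
factor `1`). -/
def fredholmDet (T : H →L[ℂ] H) : ℂ :=
  ∏' μ : ℂ, (1 + μ) ^ algMult T μ

/-- The Fredholm determinant `det (I + T)` is well defined: all nonzero eigenvalues have finite
algebraic multiplicity, the eigenvalues repeated according to multiplicity form an absolutely
summable family, and the product of the factors `1 + λ_j` converges. -/
def FredholmDetWellDefined (T : H →L[ℂ] H) : Prop :=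
  (∀ μ : ℂ, μ ≠ 0 → FiniteDimensional ℂ (rootSpace T μ)) ∧
  (Summable fun μ : ℂ => (algMult T μ : ℝ) * ‖μ‖) ∧
  Multipliable fun μ : ℂ => (1 + μ) ^ algMult T μ

end Hilbert

/-- The gaussian measure on `ℝ^∞`: the infinite product of standard gaussian measures on `ℝ`. -/
def gaussianInf : Measure (ℕ → ℝ) :=
  Measure.infinitePi fun _ : ℕ => gaussianReal 0 1

/-- `A : ℝ^∞ → ℝ^∞` is the everywhere defined transformation induced by the matrix `a`:
`(A x)_i = ∑_j a_{ij} x_j`, all series being convergent. -/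
def InducesTransformation (a : ℕ → ℕ → ℝ) (A : (ℕ → ℝ) → (ℕ → ℝ)) : Prop :=
  ∀ (x : ℕ → ℝ) (i : ℕ),
    Tendsto (fun n => ∑ j ∈ Finset.range n, a i j * x j) atTop (𝓝 (A x i))

/-- `B` is invertible up to `ν`-null sets: it restricts to a bijection between measurable sets
`D` and `E` of full measure, with an inverse given by a measurable map. -/
def InvertibleModNull {X : Type*} [MeasurableSpace X] (ν : Measure X) (B : X → X) : Prop :=
  Measurable B ∧
  ∃ (D E : Set X) (A : X → X),
    MeasurableSet D ∧ MeasurableSet E ∧ ν Dᶜ = 0 ∧ ν Eᶜ = 0 ∧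
    Set.MapsTo B D E ∧ Set.MapsTo A E D ∧ Set.InvOn A B D E ∧ Measurable A

end

/-!
The entries of `a = bhat` are absolutely summable, so `T = Bhat` is the sum of an absolutely
convergent series of rank-one operators, and hence `∑ |⟨f_k, T e_k⟩| < ∞` for all orthonormal
families `e` and `f`. Taking for `e` an eigenbasis of `T* T` and `f_k = T e_k / ‖T e_k‖` gives the
trace class property; taking `e = f` an eigenbasis of the self-adjoint operator `T` gives the
summability of its eigenvalues, and hence all claims on the determinant.

On sequences, let `r_i = ∑_j |a_{ij}|`. By the Cauchy-Schwarz inequality and the symmetry of `a`,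
the matrix `a` maps the weighted space `ℓ²(r)` into `ℓ²`, and `∑_i |x_i² - (x + a x)_i²|` is bounded
by a multiple of `∑_i x_i² r_i`. If `1 + T` is invertible, then `x ↦ x + a x` is bijective on `ℓ²`,
hence also on `ℓ²(r)`, and the latter space has full Gaussian measure because `r` is summable.
-/

section Nuclear

variable {𝕜 : Type*} [RCLike 𝕜] {H : Type u} [NormedAddCommGroup H] [InnerProductSpace 𝕜 H]

/-- `T` is nuclear: it is the sum of a series of rank-one operators whose norms are summable.
The index type is left arbitrary so that double series need not be enumerated. -/
def IsNuclear (T : H →L[𝕜] H) : Prop :=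
  ∃ (κ : Type) (x y : κ → H), HasSum (fun n => InnerProductSpace.rankOne 𝕜 (x n) (y n)) T ∧
    Summable fun n => ‖x n‖ * ‖y n‖

theorem isCompactOperator_rankOne (x y : H) :
    IsCompactOperator (InnerProductSpace.rankOne 𝕜 x y) := by
  rw [InnerProductSpace.rankOne_def']
  exact (isCompactOperator_of_locallyCompactSpace_dom (innerSL 𝕜 y)).clm_comp
    (ContinuousLinearMap.toSpanSingleton 𝕜 x)

theorem IsNuclear.isCompactOperator [CompleteSpace H] {T : H →L[𝕜] H} (hT : IsNuclear T) :
    IsCompactOperator T := by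
  obtain ⟨κ, x, y, hxy, -⟩ := hT
  exact isCompactOperator_of_tendsto hxy (.of_forall fun s =>
    sum_mem (S := compactOperator (RingHom.id 𝕜) H H)
      (f := fun n => InnerProductSpace.rankOne 𝕜 (x n) (y n)) fun n _ =>
      isCompactOperator_rankOne (x n) (y n))

theorem sum_norm_inner_mul_norm_inner_le {ι : Type*} {e f : ι → H} (he : Orthonormal 𝕜 e)
    (hf : Orthonormal 𝕜 f) (x y : H) (s : Finset ι) :
    ∑ k ∈ s, ‖inner 𝕜 (f k) x‖ * ‖inner 𝕜 y (e k)‖ ≤ ‖x‖ * ‖y‖ := by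
  have hx : ∑ k ∈ s, ‖inner 𝕜 (f k) x‖ ^ 2 ≤ ‖x‖ ^ 2 := hf.sum_inner_products_le x
  have hy : ∑ k ∈ s, ‖inner 𝕜 y (e k)‖ ^ 2 ≤ ‖y‖ ^ 2 := by
    simpa only [norm_inner_symm y] using he.sum_inner_products_le y
  calc ∑ k ∈ s, ‖inner 𝕜 (f k) x‖ * ‖inner 𝕜 y (e k)‖
      ≤ √(∑ k ∈ s, ‖inner 𝕜 (f k) x‖ ^ 2) * √(∑ k ∈ s, ‖inner 𝕜 y (e k)‖ ^ 2) :=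
        Real.sum_mul_le_sqrt_mul_sqrt _ _ _
    _ ≤ √(‖x‖ ^ 2) * √(‖y‖ ^ 2) := by gcongr
    _ = ‖x‖ * ‖y‖ := by rw [Real.sqrt_sq (norm_nonneg x), Real.sqrt_sq (norm_nonneg y)]

theorem IsNuclear.summable_norm_inner {ι : Type*} {T : H →L[𝕜] H} (hT : IsNuclear T)
    {e f : ι → H} (he : Orthonormal 𝕜 e) (hf : Orthonormal 𝕜 f) :
    Summable fun k => ‖inner 𝕜 (f k) (T (e k))‖ := by
  obtain ⟨κ, x, y, hsum, hxy⟩ := hT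
  refine summable_of_sum_le (fun k => norm_nonneg _) (c := ∑' n, ‖x n‖ * ‖y n‖) fun s => ?_
  have hcont : Continuous fun S : H →L[𝕜] H => ∑ k ∈ s, ‖inner 𝕜 (f k) (S (e k))‖ := by fun_prop
  refine le_of_tendsto ((hcont.tendsto T).comp hsum) (.of_forall fun t => ?_)
  calc ∑ k ∈ s, ‖inner 𝕜 (f k) ((∑ n ∈ t, InnerProductSpace.rankOne 𝕜 (x n) (y n)) (e k))‖
      ≤ ∑ k ∈ s, ∑ n ∈ t, ‖inner 𝕜 (f k) (x n)‖ * ‖inner 𝕜 (y n) (e k)‖ := by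
        refine Finset.sum_le_sum fun k _ => ?_
        rw [sum_apply, inner_sum]
        refine (norm_sum_le _ _).trans_eq (Finset.sum_congr rfl fun n _ => ?_)
        rw [InnerProductSpace.rankOne_apply, inner_smul_right, norm_mul, mul_comm]
    _ = ∑ n ∈ t, ∑ k ∈ s, ‖inner 𝕜 (f k) (x n)‖ * ‖inner 𝕜 (y n) (e k)‖ := Finset.sum_comm
    _ ≤ ∑ n ∈ t, ‖x n‖ * ‖y n‖ :=
        Finset.sum_le_sum fun n _ => sum_norm_inner_mul_norm_inner_le he hf (x n) (y n) s
    _ ≤ ∑' n, ‖x n‖ * ‖y n‖ :=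
        hxy.sum_le_tsum t fun n _ => mul_nonneg (norm_nonneg _) (norm_nonneg _)

end Nuclear

section Eigenbasis

variable {𝕜 : Type*} [RCLike 𝕜] {H : Type u} [NormedAddCommGroup H] [InnerProductSpace 𝕜 H]

theorem exists_hilbertBasis_sigma_of_orthogonalFamily [CompleteSpace H] {ι : Type*}
    {V : ι → Submodule 𝕜 H} (hV : OrthogonalFamily 𝕜 (fun i => V i) fun i => (V i).subtypeₗᵢ)
    (hV_dense : (⨆ i, V i)ᗮ = ⊥) {κ : ι → Type*} (v : ∀ i, HilbertBasis (κ i) 𝕜 (V i)) :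
    ∃ e : HilbertBasis (Σ i, κ i) 𝕜 H, ∀ k, e k = v k.1 k.2 := by
  have ho : Orthonormal 𝕜 fun k : Σ i, κ i => (v k.1 k.2 : H) :=
    hV.orthonormal_sigma_orthonormal (v_family := fun i => v i) fun i => (v i).orthonormal
  have hspan : (Submodule.span 𝕜 (Set.range fun k : Σ i, κ i => (v k.1 k.2 : H)))ᗮ = ⊥ := by
    refine (Submodule.eq_bot_iff _).2 fun x hx => (Submodule.mem_bot 𝕜).1 ?_
    rw [← hV_dense, ← Submodule.iInf_orthogonal, Submodule.mem_iInf]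
    intro i
    have hzero : (innerSL 𝕜 x).comp (V i).subtypeL = 0 :=
      ContinuousLinearMap.ext_on (Submodule.dense_iff_topologicalClosure_eq_top.2 (v i).dense_span)
        (Set.forall_mem_range.2 fun j => Submodule.inner_left_of_mem_orthogonal
          (Submodule.subset_span (Set.mem_range_self (⟨i, j⟩ : Σ i, κ i))) hx)
    exact (Submodule.mem_orthogonal' _ _).2 fun y hy => DFunLike.congr_fun hzero ⟨y, hy⟩
  exact ⟨HilbertBasis.mkOfOrthogonalEqBot ho hspan,
    congrFun (HilbertBasis.coe_mkOfOrthogonalEqBot ho hspan)⟩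

/-- A Hilbert basis of eigenvectors of `T`, obtained by joining Hilbert bases of the eigenspaces
of all scalars `μ` (`index μ` is empty if `μ` is not an eigenvalue). The eigenvalue belonging to
the basis vector with index `k` is `k.1`. -/
structure Eigenbasis (T : H →L[𝕜] H) where
  index : 𝕜 → Type u
  eigenspaceBasis (μ : 𝕜) :
    HilbertBasis (index μ) 𝕜 (Module.End.eigenspace (T : H →ₗ[𝕜] H) μ)
  basis : HilbertBasis (Σ μ, index μ) 𝕜 H
  basis_apply (k : Σ μ, index μ) : basis k = eigenspaceBasis k.1 k.2

theorem exists_eigenbasis [CompleteSpace H] {T : H →L[𝕜] H} (hT : IsCompactOperator T)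
    (hs : T.IsSymmetric) : Nonempty (Eigenbasis T) := by
  have hcomplete (μ : 𝕜) : CompleteSpace (Module.End.eigenspace (T : H →ₗ[𝕜] H) μ) := by
    have hclosed : IsClosed {x | T x = μ • x} :=
      isClosed_eq T.continuous (continuous_const_smul μ)
    have heq : (Module.End.eigenspace (T : H →ₗ[𝕜] H) μ : Set H) = {x | T x = μ • x} := by
      ext x
      exact Module.End.mem_eigenspace_iff
    exact (heq ▸ hclosed).completeSpace_coe
  choose w v _ using fun μ => exists_hilbertBasis 𝕜 (Module.End.eigenspace (T : H →ₗ[𝕜] H) μ)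
  obtain ⟨e, he⟩ := exists_hilbertBasis_sigma_of_orthogonalFamily hs.orthogonalFamily_eigenspaces
    (ContinuousLinearMap.orthogonalComplement_iSup_eigenspaces_eq_bot hT hs) v
  exact ⟨⟨fun μ => w μ, v, e, he⟩⟩

namespace Eigenbasis

variable {T : H →L[𝕜] H} (b : Eigenbasis T)

theorem apply_basis (k : Σ μ, b.index μ) : T (b.basis k) = k.1 • b.basis k := by
  rw [b.basis_apply]
  exact Module.End.mem_eigenspace_iff.1 (b.eigenspaceBasis k.1 k.2).2

theorem inner_basis_apply_basis (k : Σ μ, b.index μ) :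
    inner 𝕜 (b.basis k) (T (b.basis k)) = k.1 := by
  rw [b.apply_basis, inner_smul_right, inner_self_eq_norm_sq_to_K, b.basis.orthonormal.1 k]
  simp

theorem summable_norm_eigenvalue (hT : IsNuclear T) :
    Summable fun k : Σ μ, b.index μ => ‖k.1‖ := by
  simpa only [b.inner_basis_apply_basis] using
    hT.summable_norm_inner b.basis.orthonormal b.basis.orthonormal

variable {μ : 𝕜}

theorem finite_index [CompleteSpace H] (hT : IsCompactOperator T) (hμ : μ ≠ 0) :
    Finite (b.index μ) :=
  have := ContinuousLinearMap.finite_dimensional_eigenspace hT μ hμ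
  (b.eigenspaceBasis μ).orthonormal.linearIndependent.finite

theorem finrank_eigenspace [Finite (b.index μ)] :
    Module.finrank 𝕜 (Module.End.eigenspace (T : H →ₗ[𝕜] H) μ) = Nat.card (b.index μ) := by
  let := Fintype.ofFinite (b.index μ)
  rw [Module.finrank_eq_card_basis (b.eigenspaceBasis μ).toOrthonormalBasis.toBasis,
    Nat.card_eq_fintype_card]

theorem isEmpty_index_iff :
    IsEmpty (b.index μ) ↔ Module.End.eigenspace (T : H →ₗ[𝕜] H) μ = ⊥ := by
  refine ⟨fun _ => (Submodule.eq_bot_iff _).2 fun y hy => ?_, fun hbot => ⟨fun i => ?_⟩⟩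
  · exact congrArg Subtype.val (((b.eigenspaceBasis μ).hasSum_repr ⟨y, hy⟩).unique hasSum_empty)
  · have hzero := (Submodule.eq_bot_iff _).1 hbot _ (b.eigenspaceBasis μ i).2
    exact (b.eigenspaceBasis μ).orthonormal.ne_zero i (Subtype.ext hzero)

end Eigenbasis

end Eigenbasis

section TraceClass

variable {H : Type u} [NormedAddCommGroup H] [InnerProductSpace ℂ H] [CompleteSpace H]

theorem norm_cfcAbs_apply (T : H →L[ℂ] H) (x : H) : ‖CFC.abs T x‖ = ‖T x‖ := by
  have hadj : ContinuousLinearMap.adjoint (CFC.abs T) = CFC.abs T :=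
    (CFC.abs_nonneg T).isSelfAdjoint.adjoint_eq
  have hsq : ContinuousLinearMap.adjoint (CFC.abs T) ∘L CFC.abs T =
      ContinuousLinearMap.adjoint T ∘L T := hadj.symm ▸ CFC.abs_mul_abs T
  rw [ContinuousLinearMap.apply_norm_eq_sqrt_inner_adjoint_left, hsq,
    ← ContinuousLinearMap.apply_norm_eq_sqrt_inner_adjoint_left]

theorem orthonormal_normalize_apply_eigenbasis {T : H →L[ℂ] H} (b : Eigenbasis (star T * T)) :
    Orthonormal ℂ fun k : {k // T (b.basis k) ≠ 0} =>
      ((‖T (b.basis k)‖⁻¹ : ℝ) : ℂ) • T (b.basis k) := by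
  have hinner (k l) : inner ℂ (T (b.basis k)) (T (b.basis l)) =
      l.1 * inner ℂ (b.basis k) (b.basis l) := by
    rw [← ContinuousLinearMap.adjoint_inner_right, ← inner_smul_right, ← b.apply_basis]
    rfl
  refine ⟨fun k => ?_, fun k l hkl => ?_⟩
  · rw [norm_smul]
    simp [k.2]
  · simp [inner_smul_left, inner_smul_right, hinner,
      b.basis.orthonormal.2 (Subtype.coe_ne_coe.2 hkl)]

theorem IsNuclear.isTraceClass {T : H →L[ℂ] H} (hT : IsNuclear T) : IsTraceClass T := by
  have hcompact : IsCompactOperator (star T * T) := hT.isCompactOperator.clm_comp (star T)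
  obtain ⟨b⟩ := exists_eigenbasis hcompact
    (ContinuousLinearMap.isSelfAdjoint_iff_isSymmetric.1 (.star_mul_self T))
  refine ⟨_, b.basis, ?_⟩
  have hsum : Summable fun k : {k // T (b.basis k) ≠ 0} => ‖T (b.basis k)‖ := by
    refine (hT.summable_norm_inner (b.basis.orthonormal.comp _ Subtype.val_injective)
      (orthonormal_normalize_apply_eigenbasis b)).congr fun k => ?_
    rw [inner_smul_left, Function.comp_apply, inner_self_eq_norm_sq_to_K]
    simp [sq, k.2]
  have hsum' : Summable fun k => ‖T (b.basis k)‖ := by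
    refine (Subtype.val_injective.summable_iff fun k hk => ?_).1 hsum
    simpa using hk
  refine hsum'.of_nonneg_of_le (fun _ => norm_nonneg _) fun k => ?_
  calc ‖inner ℂ (CFC.abs T (b.basis k)) (b.basis k)‖
      ≤ ‖CFC.abs T (b.basis k)‖ * ‖b.basis k‖ := norm_inner_le_norm _ _
    _ = ‖T (b.basis k)‖ := by rw [norm_cfcAbs_apply, b.basis.orthonormal.1 k, mul_one]

end TraceClass

section FredholmDeterminant

theorem tprod_one_add_ne_zero_iff {ι R : Type*} [NormedCommRing R] [NormOneClass R]
    [NormMulClass R] [CompleteSpace R] {f : ι → R} (hf : Summable fun i => ‖f i‖) :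
    ∏' i, (1 + f i) ≠ 0 ↔ ∀ i, 1 + f i ≠ 0 :=
  ⟨fun h i hi => h (tprod_of_exists_eq_zero ⟨i, hi⟩),
    fun h => tprod_one_add_ne_zero_of_summable h hf⟩

theorem isUnit_one_add_iff_eigenspace_eq_bot {𝕜 X : Type*} [NontriviallyNormedField 𝕜]
    [NormedAddCommGroup X] [NormedSpace 𝕜 X] [CompleteSpace X] {T : X →L[𝕜] X}
    (hT : IsCompactOperator T) :
    IsUnit (1 + T) ↔ Module.End.eigenspace (T : X →ₗ[𝕜] X) (-1) = ⊥ := by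
  have hspec : -1 ∈ spectrum 𝕜 T ↔ ¬ IsUnit (1 + T) := by
    rw [spectrum.mem_iff, ← IsUnit.neg_iff]
    simp [add_comm]
  rw [← not_iff_not, ← hspec, ← hT.hasEigenvalue_iff_mem_spectrum (by simp),
    Module.End.hasEigenvalue_iff]

variable {H : Type u} [NormedAddCommGroup H] [InnerProductSpace ℂ H] {T : H →L[ℂ] H}

theorem rootSpace_eq_eigenspace (hs : T.IsSymmetric) (μ : ℂ) :
    rootSpace T μ = Module.End.eigenspace (T : H →ₗ[ℂ] H) μ :=
  (LinearMap.IsSymmetric.isFinitelySemisimple hs).maxGenEigenspace_eq_eigenspace μ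

namespace Eigenbasis

theorem algMult_eq_card (b : Eigenbasis T) (hs : T.IsSymmetric) {μ : ℂ} [Finite (b.index μ)] :
    algMult T μ = Nat.card (b.index μ) := by
  rw [algMult, rootSpace_eq_eigenspace hs, b.finrank_eigenspace]

theorem hasProd_one_add_pow_algMult [CompleteSpace H] (b : Eigenbasis T) (hT : IsNuclear T)
    (hs : T.IsSymmetric) :
    HasProd (fun μ : ℂ => (1 + μ) ^ algMult T μ) (∏' k : Σ μ, b.index μ, (1 + k.1)) := by
  refine (multipliable_one_add_of_summable (b.summable_norm_eigenvalue hT)).hasProd.sigma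
    fun μ => ?_
  rcases eq_or_ne μ 0 with rfl | hμ
  · simp
  · have := b.finite_index hT.isCompactOperator hμ
    let := Fintype.ofFinite (b.index μ)
    have h := hasProd_fintype fun _ : b.index μ => 1 + μ
    rwa [Finset.prod_const, Finset.card_univ, ← Nat.card_eq_fintype_card,
      ← b.algMult_eq_card hs] at h

theorem fredholmDet_eq_tprod [CompleteSpace H] (b : Eigenbasis T) (hT : IsNuclear T)
    (hs : T.IsSymmetric) :
    fredholmDet T = ∏' k : Σ μ, b.index μ, (1 + k.1) :=
  (b.hasProd_one_add_pow_algMult hT hs).tprod_eq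

end Eigenbasis

variable [CompleteSpace H]

theorem IsNuclear.summable_algMult_mul_norm (hT : IsNuclear T) (hs : T.IsSymmetric) :
    Summable fun μ : ℂ => (algMult T μ : ℝ) * ‖μ‖ := by
  obtain ⟨b⟩ := exists_eigenbasis hT.isCompactOperator hs
  refine ((summable_sigma_of_nonneg fun k => norm_nonneg k.1).1
    (b.summable_norm_eigenvalue hT)).2.congr fun μ => ?_
  rcases eq_or_ne μ 0 with rfl | hμ
  · simp
  · have := b.finite_index hT.isCompactOperator hμ
    simp only [b.algMult_eq_card hs, tsum_const, nsmul_eq_mul]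

theorem IsNuclear.fredholmDetWellDefined (hT : IsNuclear T) (hs : T.IsSymmetric) :
    FredholmDetWellDefined T := by
  obtain ⟨b⟩ := exists_eigenbasis hT.isCompactOperator hs
  refine ⟨fun μ hμ => ?_, hT.summable_algMult_mul_norm hs,
    (b.hasProd_one_add_pow_algMult hT hs).multipliable⟩
  rw [rootSpace_eq_eigenspace hs]
  exact ContinuousLinearMap.finite_dimensional_eigenspace hT.isCompactOperator μ hμ

theorem IsNuclear.fredholmDet_ne_zero_iff (hT : IsNuclear T) (hs : T.IsSymmetric) :
    fredholmDet T ≠ 0 ↔ IsUnit (1 + T) := by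
  obtain ⟨b⟩ := exists_eigenbasis hT.isCompactOperator hs
  calc fredholmDet T ≠ 0 ↔ ∀ k : Σ μ, b.index μ, 1 + k.1 ≠ 0 := by
        rw [b.fredholmDet_eq_tprod hT hs,
          tprod_one_add_ne_zero_iff (b.summable_norm_eigenvalue hT)]
    _ ↔ IsEmpty (b.index (-1)) := by
        refine ⟨fun h => ⟨fun i => h ⟨-1, i⟩ (by simp)⟩, fun h k hk => ?_⟩
        exact h.false (eq_neg_of_add_eq_zero_right hk ▸ k.2)
    _ ↔ IsUnit (1 + T) := by
        rw [b.isEmpty_index_iff, isUnit_one_add_iff_eigenspace_eq_bot hT.isCompactOperator]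

end FredholmDeterminant

section WeightedEstimates

/-- The absolute row sum `∑_j |a_{ij}|`, which serves as the natural weight of the matrix `a`
(with value `0` if the series diverges). -/
noncomputable def absRowSum {ι κ : Type*} (a : ι → κ → ℝ) (i : ι) : ℝ :=
  ∑' j, |a i j|

theorem absRowSum_nonneg {ι κ : Type*} (a : ι → κ → ℝ) (i : ι) : 0 ≤ absRowSum a i :=
  tsum_nonneg fun _ => abs_nonneg _

theorem sq_le_tsum_abs_mul_tsum_abs_mul_sq {ι : Type*} {c x : ι → ℝ} {y : ℝ}
    (hy : HasSum (fun j => c j * x j) y) (hc : Summable fun j => |c j|)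
    (hcx : Summable fun j => |c j| * x j ^ 2) :
    y ^ 2 ≤ (∑' j, |c j|) * ∑' j, |c j| * x j ^ 2 :=
  le_of_tendsto_of_tendsto' (hy.pow 2) (Tendsto.mul hc.hasSum hcx.hasSum) fun s =>
    Finset.sum_sq_le_sum_mul_sum_of_sq_le_mul s (fun j _ => abs_nonneg (c j))
      (fun j _ => by positivity) fun j _ => by
        rw [← mul_assoc, abs_mul_abs_self, mul_pow, sq (c j)]

theorem abs_sq_sub_add_sq_le {x y r s R : ℝ} (hr : 0 ≤ r) (hs : 0 ≤ s) (hrR : r ≤ R)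
    (hy : y ^ 2 ≤ r * s) : |x ^ 2 - (x + y) ^ 2| ≤ x ^ 2 * r + (1 + R) * s := by
  have hcross : |2 * x * y| ≤ x ^ 2 * r + s := by
    refine abs_le_of_sq_le_sq ?_ (by positivity)
    calc (2 * x * y) ^ 2 = 4 * x ^ 2 * y ^ 2 := by ring
      _ ≤ 4 * x ^ 2 * (r * s) := by gcongr
      _ = 4 * (x ^ 2 * r) * s := by ring
      _ ≤ (x ^ 2 * r + s) ^ 2 := four_mul_le_sq_add _ _
  calc |x ^ 2 - (x + y) ^ 2| = |2 * x * y + y ^ 2| := by rw [← abs_neg]; ring_nf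
    _ ≤ |2 * x * y| + |y ^ 2| := abs_add_le _ _
    _ = |2 * x * y| + y ^ 2 := by rw [abs_sq]
    _ ≤ x ^ 2 * r + s + R * s := by gcongr; exact hy.trans (by gcongr)
    _ = x ^ 2 * r + (1 + R) * s := by ring

theorem summable_absRowSum {ι κ : Type*} {a : ι → κ → ℝ}
    (ha : Summable fun q : ι × κ => |a q.1 q.2|) : Summable (absRowSum a) :=
  ha.prod

theorem summable_abs_mul_comp_fst {ι κ : Type*} {a : ι → κ → ℝ}
    (ha : ∀ i, Summable fun j => |a i j|) {f : ι → ℝ} (hf : ∀ i, 0 ≤ f i)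
    (hfa : Summable fun i => f i * absRowSum a i) :
    Summable fun q : ι × κ => |a q.1 q.2| * f q.1 := by
  have hrow (i : ι) : ∑' j, |a i j| * f i = f i * absRowSum a i := by
    rw [tsum_mul_right, mul_comm, absRowSum]
  refine (summable_prod_of_nonneg fun q => mul_nonneg (abs_nonneg _) (hf q.1)).2
    ⟨fun i => (ha i).mul_right (f i), ?_⟩
  simpa only [hrow] using hfa

variable {ι : Type*} {a : ι → ι → ℝ}

theorem summable_abs_mul_comp_snd (ha : ∀ i, Summable fun j => |a i j|)
    (h_symm : ∀ i j, a i j = a j i) {f : ι → ℝ} (hf : ∀ i, 0 ≤ f i)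
    (hfa : Summable fun i => f i * absRowSum a i) :
    Summable fun q : ι × ι => |a q.1 q.2| * f q.2 :=
  (summable_abs_mul_comp_fst ha hf hfa).prod_symm.congr fun q => by
    rw [Prod.fst_swap, Prod.snd_swap, h_symm]

theorem tsum_tsum_abs_mul (ha : ∀ i, Summable fun j => |a i j|)
    (h_symm : ∀ i j, a i j = a j i) {f : ι → ℝ} (hf : ∀ i, 0 ≤ f i)
    (hfa : Summable fun i => f i * absRowSum a i) :
    ∑' i, ∑' j, |a i j| * f j = ∑' i, f i * absRowSum a i := by
  rw [← Summable.tsum_comm (f := fun i j => |a i j| * f j)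
    (summable_abs_mul_comp_snd ha h_symm hf hfa)]
  refine tsum_congr fun i => ?_
  simp_rw [h_symm _ i]
  rw [tsum_mul_right, mul_comm, absRowSum]

variable (ha : Summable fun q : ι × ι => |a q.1 q.2|) (h_symm : ∀ i j, a i j = a j i)
  {x y : ι → ℝ} (hx : Summable fun i => x i ^ 2 * absRowSum a i)
  (hy : ∀ i, HasSum (fun j => a i j * x j) (y i))
include ha h_symm hx hy

theorem sq_le_absRowSum_mul_tsum (i : ι) :
    y i ^ 2 ≤ absRowSum a i * ∑' j, |a i j| * x j ^ 2 :=
  sq_le_tsum_abs_mul_tsum_abs_mul_sq (hy i) (ha.prod_factor i)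
    ((summable_abs_mul_comp_snd ha.prod_factor h_symm (fun j => sq_nonneg (x j)) hx).prod_factor i)

theorem summable_sq_of_hasSum_mul : Summable fun i => y i ^ 2 := by
  have hs :=
    (summable_abs_mul_comp_snd ha.prod_factor h_symm (fun j => sq_nonneg (x j)) hx).prod
  refine (hs.mul_left (∑' i, absRowSum a i)).of_nonneg_of_le (fun i => sq_nonneg _) fun i =>
    (sq_le_absRowSum_mul_tsum ha h_symm hx hy i).trans ?_
  gcongr
  exact (summable_absRowSum ha).le_tsum i fun j _ => absRowSum_nonneg a j

theorem summable_sq_sub_add_sq_and_abs_tsum_le :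
    (Summable fun i => x i ^ 2 - (x i + y i) ^ 2) ∧
      |∑' i, (x i ^ 2 - (x i + y i) ^ 2)| ≤
        (2 + ∑' i, absRowSum a i) * ∑' i, x i ^ 2 * absRowSum a i := by
  have hs :=
    (summable_abs_mul_comp_snd ha.prod_factor h_symm (fun j => sq_nonneg (x j)) hx).prod
  have hdom := hx.add (hs.mul_left (1 + ∑' i, absRowSum a i))
  have hle (i : ι) : ‖x i ^ 2 - (x i + y i) ^ 2‖ ≤
      x i ^ 2 * absRowSum a i + (1 + ∑' i, absRowSum a i) * ∑' j, |a i j| * x j ^ 2 :=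
    abs_sq_sub_add_sq_le (absRowSum_nonneg a i) (tsum_nonneg fun j => by positivity)
      ((summable_absRowSum ha).le_tsum i fun j _ => absRowSum_nonneg a j)
      (sq_le_absRowSum_mul_tsum ha h_symm hx hy i)
  refine ⟨hdom.of_norm_bounded hle, (tsum_of_norm_bounded hdom.hasSum hle).trans_eq ?_⟩
  rw [hx.tsum_add (hs.mul_left _), tsum_mul_left,
    tsum_tsum_abs_mul ha.prod_factor h_symm (fun j => sq_nonneg (x j)) hx]
  ring

omit hx in
theorem summable_sq_sub_add_sq_and_abs_tsum_le_of_absRowSum_le {p : ι → ℝ} {K : ℝ}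
    (h_row : ∀ i, absRowSum a i ≤ K * p i) (hxp : Summable fun i => x i ^ 2 * p i) :
    (Summable fun i => x i ^ 2 - (x i + y i) ^ 2) ∧
      |∑' i, (x i ^ 2 - (x i + y i) ^ 2)| ≤
        (2 + ∑' i, absRowSum a i) * K * ∑' i, x i ^ 2 * p i := by
  have hS : 0 ≤ ∑' i, absRowSum a i := tsum_nonneg (absRowSum_nonneg a)
  have hle (i : ι) : x i ^ 2 * absRowSum a i ≤ K * (x i ^ 2 * p i) := by
    rw [mul_left_comm]
    gcongr
    exact h_row i
  have hx : Summable fun i => x i ^ 2 * absRowSum a i :=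
    (hxp.mul_left K).of_nonneg_of_le
      (fun i => mul_nonneg (sq_nonneg _) (absRowSum_nonneg a i)) hle
  obtain ⟨hsum, hbound⟩ := summable_sq_sub_add_sq_and_abs_tsum_le ha h_symm hx hy
  refine ⟨hsum, hbound.trans ?_⟩
  rw [mul_assoc, ← tsum_mul_left (a := K)]
  exact mul_le_mul_of_nonneg_left (hx.tsum_le_tsum hle (hxp.mul_left K)) (by positivity)

end WeightedEstimates

section RowFinite

variable {ι κ : Type*} (a : ι → κ → ℝ) (ha : ∀ i, (Function.support (a i)).Finite)

/-- The transformation `(a x)_i = ∑_j a_{ij} x_j` of the space of all sequences defined by a matrix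
with finitely supported rows. -/
noncomputable def rowFiniteMap : (κ → ℝ) →L[ℝ] (ι → ℝ) :=
  ContinuousLinearMap.pi fun i => ∑ j ∈ (ha i).toFinset, a i j • ContinuousLinearMap.proj j

theorem hasSum_rowFiniteMap_apply (x : κ → ℝ) (i : ι) :
    HasSum (fun j => a i j * x j) (rowFiniteMap a ha x i) := by
  have happly : rowFiniteMap a ha x i = ∑ j ∈ (ha i).toFinset, a i j * x j := by
    simp [rowFiniteMap]
  rw [happly]
  refine hasSum_sum_of_ne_finset_zero fun j hj => ?_
  rw [Set.Finite.mem_toFinset, Function.notMem_support] at hj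
  rw [hj, zero_mul]

end RowFinite

theorem hasSum_onePlus_mul {a : ℕ → ℕ → ℝ} {x : ℕ → ℝ} {i : ℕ} {y : ℝ}
    (hy : HasSum (fun j => a i j * x j) y) : HasSum (fun j => onePlus a i j * x j) (x i + y) := by
  have hdiag : HasSum (fun j => (if i = j then 1 else 0) * x j) (x i) := by
    simpa using hasSum_single (f := fun j => (if i = j then 1 else 0) * x j) i fun j hj => by
      simp [hj.symm]
  simpa only [onePlus, add_mul] using hdiag.add hy

section GaussianMeasure

theorem ae_summable_norm_smul_comp {ι Ω X E : Type*} [Countable ι] [MeasurableSpace Ω]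
    [MeasurableSpace X] [NormedAddCommGroup E] [NormedSpace ℝ E] {μ : Measure Ω} {ν : Measure X}
    {φ : ι → Ω → X} (hφ : ∀ i, MeasurePreserving (φ i) μ ν) {g : X → E} (hg : Integrable g ν)
    {w : ι → ℝ} (hw : Summable fun i => ‖w i‖) :
    ∀ᵐ x ∂μ, Summable fun i => ‖w i • g (φ i x)‖ := by
  refine summable_norm_of_tsum_eLpNorm_ne_top le_rfl (f := fun i => w i • (g ∘ φ i))
    (fun i => ((hφ i).integrable_comp_of_integrable hg).1.const_smul (w i)) ?_
  have heLp (i : ι) : eLpNorm (w i • (g ∘ φ i)) 1 μ = ‖w i‖ₑ * eLpNorm g 1 ν := by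
    rw [eLpNorm_const_smul, eLpNorm_comp_measurePreserving hg.1 (hφ i)]
  simp_rw [heLp, ENNReal.tsum_mul_right, ← ofReal_norm]
  exact ENNReal.mul_ne_top hw.tsum_ofReal_ne_top (memLp_one_iff_integrable.2 hg).2.ne

variable {ι : Type*}

/-- The space of all real sequences `x` with `∑_i x_i² w_i < ∞`. -/
def weightedEllTwo (w : ι → ℝ) (hw : ∀ i, 0 ≤ w i) : Submodule ℝ (ι → ℝ) where
  carrier := {x | Summable fun i => x i ^ 2 * w i}
  zero_mem' := by simp [summable_zero]
  add_mem' {x y} hx hy := by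
    refine ((hx.add hy).mul_left 2).of_nonneg_of_le
      (fun i => mul_nonneg (sq_nonneg _) (hw i)) fun i => ?_
    rw [← add_mul, ← mul_assoc]
    exact mul_le_mul_of_nonneg_right add_sq_le (hw i)
  smul_mem' c x hx := by simpa [mul_pow, mul_assoc] using hx.mul_left (c ^ 2)

variable {w : ι → ℝ} {hw : ∀ i, 0 ≤ w i}

theorem weightedEllTwo_one_le (hw_sum : Summable w) :
    weightedEllTwo 1 (fun _ => zero_le_one) ≤ weightedEllTwo w hw := fun x hx => by
  refine Summable.of_nonneg_of_le (fun i => mul_nonneg (sq_nonneg _) (hw i)) (fun i => ?_)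
    (hx.mul_right (∑' i, w i))
  rw [Pi.one_apply, mul_one]
  gcongr
  exact hw_sum.le_tsum i fun j _ => hw j

theorem measurableSet_weightedEllTwo [Countable ι] :
    MeasurableSet (weightedEllTwo w hw : Set (ι → ℝ)) := by
  have hset : (weightedEllTwo w hw : Set (ι → ℝ)) =
      {x | ∑' i, ENNReal.ofReal (x i ^ 2 * w i) ≠ ⊤} := by
    ext x
    refine ⟨fun hx => Summable.tsum_ofReal_ne_top hx, fun hx => ?_⟩
    refine (ENNReal.summable_toReal hx).congr fun i => ?_
    exact ENNReal.toReal_ofReal (mul_nonneg (sq_nonneg _) (hw i))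
  rw [hset]
  exact (measurableSet_singleton _).compl.preimage (by fun_prop)

theorem ae_mem_weightedEllTwo [Countable ι] (hw_sum : Summable w) :
    ∀ᵐ x ∂Measure.infinitePi fun _ : ι => gaussianReal 0 1, x ∈ weightedEllTwo w hw := by
  have hint : Integrable (fun t : ℝ => t ^ 2) (gaussianReal 0 1) :=
    (memLp_id_gaussianReal' 2 (by simp)).integrable_sq
  filter_upwards [ae_summable_norm_smul_comp
    (measurePreserving_eval_infinitePi fun _ : ι => gaussianReal 0 1) hint hw_sum.norm] with x hx
  exact hx.of_norm.congr fun i => mul_comm _ _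

end GaussianMeasure

section MatrixOperator

variable {a : ℕ → ℕ → ℝ}

/-- The operator on `ℓ²` with matrix `a`, as the series `∑ a_{ij} ⟨e_j, ·⟩ e_i` of rank-one
operators (with value `0` unless the series is summable). -/
noncomputable def matrixOperator (a : ℕ → ℕ → ℝ) : EllTwo →L[ℂ] EllTwo :=
  ∑' q : ℕ × ℕ, (a q.1 q.2 : ℂ) •
    InnerProductSpace.rankOne ℂ (lp.single 2 q.1 (1 : ℂ) : EllTwo) (lp.single 2 q.2 (1 : ℂ))

theorem EllTwo.norm_single_one (i : ℕ) : ‖(lp.single 2 i (1 : ℂ) : EllTwo)‖ = 1 := by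
  rw [lp.norm_single (by simp), norm_one]

theorem EllTwo.inner_single_one (i : ℕ) (z : EllTwo) :
    inner ℂ (lp.single 2 i (1 : ℂ) : EllTwo) z = z i := by
  simp [lp.inner_single_left]

theorem hasSum_matrixOperator (ha : Summable fun q : ℕ × ℕ => |a q.1 q.2|) :
    HasSum (fun q : ℕ × ℕ => (a q.1 q.2 : ℂ) •
      InnerProductSpace.rankOne ℂ (lp.single 2 q.1 (1 : ℂ) : EllTwo) (lp.single 2 q.2 (1 : ℂ)))
      (matrixOperator a) :=
  Summable.hasSum <| .of_norm <| ha.congr fun q => by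
    rw [norm_smul, InnerProductSpace.norm_rankOne, EllTwo.norm_single_one, EllTwo.norm_single_one,
      mul_one, mul_one, Complex.norm_real, Real.norm_eq_abs]

theorem isNuclear_matrixOperator (ha : Summable fun q : ℕ × ℕ => |a q.1 q.2|) :
    IsNuclear (matrixOperator a) := by
  refine ⟨ℕ × ℕ, fun q => (a q.1 q.2 : ℂ) • lp.single 2 q.1 (1 : ℂ),
    fun q => lp.single 2 q.2 (1 : ℂ), ?_, ?_⟩
  · simpa only [map_smul, smul_apply] using hasSum_matrixOperator ha
  · simpa only [norm_smul, EllTwo.norm_single_one, mul_one, Complex.norm_real, Real.norm_eq_abs]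
      using ha

theorem isSymmetric_matrixOperator (ha : Summable fun q : ℕ × ℕ => |a q.1 q.2|)
    (h_symm : ∀ i j, a i j = a j i) : (matrixOperator a).IsSymmetric := by
  rw [← ContinuousLinearMap.isSelfAdjoint_iff_isSymmetric, IsSelfAdjoint]
  refine (hasSum_matrixOperator ha).star.unique ?_
  convert (Equiv.prodComm ℕ ℕ).hasSum_iff.2 (hasSum_matrixOperator ha) using 1
  funext q
  simp only [star_smul, Complex.star_def, Complex.conj_ofReal, ContinuousLinearMap.star_eq_adjoint,
    InnerProductSpace.adjoint_rankOne, Function.comp_apply, Equiv.prodComm_apply, Prod.fst_swap,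
    Prod.snd_swap, h_symm q.1 q.2]

theorem inducesOperator_matrixOperator (ha : Summable fun q : ℕ × ℕ => |a q.1 q.2|) :
    InducesOperator a (matrixOperator a) := fun z i => by
  have hterm (q : ℕ × ℕ) : ((a q.1 q.2 : ℂ) • InnerProductSpace.rankOne ℂ
      (lp.single 2 q.1 (1 : ℂ) : EllTwo) (lp.single 2 q.2 (1 : ℂ))) z i =
        if q.1 = i then (a q.1 q.2 : ℂ) * z q.2 else 0 := by
    rw [smul_apply, InnerProductSpace.rankOne_apply, EllTwo.inner_single_one]
    rw [lp.coeFn_smul, Pi.smul_apply, lp.coeFn_smul, Pi.smul_apply, lp.single_apply,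
      Pi.single_apply]
    by_cases hq : q.1 = i
    · rw [if_pos hq.symm, if_pos hq, smul_eq_mul, smul_eq_mul, mul_one]
    · rw [if_neg (Ne.symm hq), if_neg hq, smul_zero, smul_zero]
  have hsum : HasSum (fun q : ℕ × ℕ => if q.1 = i then (a q.1 q.2 : ℂ) * z q.2 else 0)
      (matrixOperator a z i) := by
    have h := ((hasSum_matrixOperator ha).mapL (ContinuousLinearMap.apply ℂ EllTwo z)).mapL
      (innerSL ℂ (lp.single 2 i (1 : ℂ) : EllTwo))
    simpa only [ContinuousLinearMap.apply_apply, innerSL_apply_apply, EllTwo.inner_single_one,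
      hterm] using h
  have hrow := ((Prod.mk_right_injective i).hasSum_iff fun q hq => if_neg ?_).2 hsum
  · simpa [Function.comp_def] using hrow
  · rintro rfl
    exact hq ⟨q.2, rfl⟩

end MatrixOperator

section Bijectivity

theorem bijOn_id_add_of_le {G : Type*} [AddCommGroup G] {S D : AddSubgroup G} (hSD : S ≤ D)
    {A : G →+ G} (hA : Set.MapsTo A D S) (hS : Set.BijOn (fun x => x + A x) S S) :
    Set.BijOn (fun x => x + A x) D D := by
  refine ⟨fun x hx => D.add_mem hx (hSD (hA hx)), fun x hx y hy hxy => ?_, fun y hy => ?_⟩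
  · have hker : x - y + A (x - y) = 0 := by
      rw [map_sub, sub_add_sub_comm, sub_eq_zero]
      exact hxy
    have hmem : x - y ∈ S := by
      rw [eq_neg_of_add_eq_zero_left hker]
      exact S.neg_mem (hA (D.sub_mem hx hy))
    exact sub_eq_zero.1 (hS.injOn hmem S.zero_mem (by simpa using hker))
  · -- Solve `x + A x = y` by `x = y + z`, where `z ∈ S` satisfies `z + A z = -A y`.
    obtain ⟨z, hz, hzy⟩ := hS.surjOn (S.neg_mem (hA hy))
    refine ⟨y + z, D.add_mem hy (hSD hz), ?_⟩
    calc y + z + A (y + z) = y + A y + (z + A z) := by rw [map_add, add_add_add_comm]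
      _ = y := by rw [show z + A z = -A y from hzy, add_neg_cancel_right]

theorem EllTwo.exists_ofReal {x : ℕ → ℝ} (hx : Summable fun i => x i ^ 2) :
    ∃ z : EllTwo, ∀ i, z i = x i :=
  ⟨⟨fun i => (x i : ℂ), memℓp_gen (by simpa using hx)⟩, fun _ => rfl⟩

theorem EllTwo.summable_re_sq (z : EllTwo) : Summable fun i => (z i).re ^ 2 := by
  refine ((memℓp_gen_iff (by simp)).1 (lp.memℓp z)).of_nonneg_of_le (fun i => sq_nonneg _)
    fun i => ?_
  rw [← sq_abs]
  simpa using pow_le_pow_left₀ (abs_nonneg _) (Complex.abs_re_le_norm (z i)) 2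

namespace InducesOperator

variable {a : ℕ → ℕ → ℝ} {T : EllTwo →L[ℂ] EllTwo} (hT : InducesOperator a T)
  {A : (ℕ → ℝ) → (ℕ → ℝ)} (hA : ∀ x i, HasSum (fun j => a i j * x j) (A x i))
include hT hA

theorem apply_ofReal {z : EllTwo} {x : ℕ → ℝ} (hz : ∀ i, z i = x i) (i : ℕ) :
    T z i = (A x i : ℂ) := by
  refine (hT z i).unique ?_
  simpa [hz] using (hA x i).mapL Complex.ofRealCLM

theorem re_apply (z : EllTwo) (i : ℕ) : (T z i).re = A (fun j => (z j).re) i := by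
  refine HasSum.unique ?_ (hA _ i)
  simpa using (hT z i).mapL Complex.reCLM

theorem bijOn_summable_sq (hu : IsUnit (1 + T)) :
    Set.BijOn (fun x => x + A x) {x | Summable fun i => x i ^ 2}
      {x | Summable fun i => x i ^ 2} := by
  have hbij : Function.Bijective ⇑(1 + T) := ContinuousLinearMap.isUnit_iff_bijective.1 hu
  have happly {z : EllTwo} {x : ℕ → ℝ} (hz : ∀ i, z i = x i) (i : ℕ) :
      (1 + T) z i = ((x + A x) i : ℝ) := by
    rw [Pi.add_apply, Complex.ofReal_add, ← hz i, ← hT.apply_ofReal hA hz i]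
    rfl
  refine ⟨fun x hx => ?_, fun x hx y hy hxy => ?_, fun y hy => ?_⟩
  · obtain ⟨z, hz⟩ := EllTwo.exists_ofReal hx
    simpa only [Set.mem_ofPred_eq, happly hz, Complex.ofReal_re] using
      EllTwo.summable_re_sq ((1 + T) z)
  · obtain ⟨z, hz⟩ := EllTwo.exists_ofReal hx
    obtain ⟨w, hw⟩ := EllTwo.exists_ofReal hy
    have hzw : z = w := hbij.1 <| lp.ext <| funext fun i => by
      rw [happly hz, happly hw, show x + A x = y + A y from hxy]
    funext i
    rw [← Complex.ofReal_inj, ← hz, ← hw, hzw]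
  · obtain ⟨w, hw⟩ := EllTwo.exists_ofReal hy
    obtain ⟨z, rfl⟩ := hbij.2 w
    refine ⟨fun i => (z i).re, EllTwo.summable_re_sq z, funext fun i => ?_⟩
    calc (z i).re + A (fun j => (z j).re) i = ((1 + T) z i).re := by
          rw [← hT.re_apply hA z i]
          rfl
      _ = y i := by rw [hw, Complex.ofReal_re]

end InducesOperator

end Bijectivity

section InvertibleModNull

theorem invertibleModNull_of_bijOn {X : Type*} [MeasurableSpace X] [StandardBorelSpace X]
    {ν : Measure X} {B : X → X} (hB : Measurable B) {D E : Set X} (hD : MeasurableSet D)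
    (hνD : ν Dᶜ = 0) (hνE : ν Eᶜ = 0) (hbij : Set.BijOn B D E) : InvertibleModNull ν B := by
  have := hD.standardBorel
  have hemb : MeasurableEmbedding (D.domRestrict B) :=
    (hB.comp measurable_subtype_coe).measurableEmbedding hbij.injOn.injective
  have hE : MeasurableSet E := by
    simpa only [Set.range_domRestrict, hbij.image_eq] using hemb.measurableSet_range
  obtain ⟨A, hA, hAB⟩ := hemb.exists_measurable_extend measurable_subtype_coe
    fun x => ⟨x⟩
  have hleft : Set.LeftInvOn A B D := fun x hx => congrFun hAB ⟨x, hx⟩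
  refine ⟨hB, D, E, A, hD, hE, hνD, hνE, hbij.mapsTo, ?_, ⟨hleft, ?_⟩, hA⟩
  · exact hleft.mapsTo hbij.surjOn
  · exact hbij.image_eq ▸ hleft.rightInvOn_image

theorem invertibleModNull_id_add {a : ℕ → ℕ → ℝ} (h_fin : ∀ i, (Function.support (a i)).Finite)
    (ha : Summable fun q : ℕ × ℕ => |a q.1 q.2|) (h_symm : ∀ i j, a i j = a j i)
    {T : EllTwo →L[ℂ] EllTwo} (hT : InducesOperator a T) (hu : IsUnit (1 + T)) :
    InvertibleModNull gaussianInf fun x => x + rowFiniteMap a h_fin x := by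
  have hrow := absRowSum_nonneg a
  have hbij : Set.BijOn (fun x => x + rowFiniteMap a h_fin x)
      (weightedEllTwo (absRowSum a) hrow) (weightedEllTwo (absRowSum a) hrow) := by
    refine bijOn_id_add_of_le (S := (weightedEllTwo 1 fun _ => zero_le_one).toAddSubgroup)
      (D := (weightedEllTwo (absRowSum a) hrow).toAddSubgroup)
      (A := (rowFiniteMap a h_fin : (ℕ → ℝ) →+ (ℕ → ℝ)))
      (weightedEllTwo_one_le (hw := hrow) (summable_absRowSum ha)) (fun x hx => ?_) ?_
    · simpa [weightedEllTwo] using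
        summable_sq_of_hasSum_mul ha h_symm hx (hasSum_rowFiniteMap_apply a h_fin x)
    · simpa [weightedEllTwo] using
        hT.bijOn_summable_sq (hasSum_rowFiniteMap_apply a h_fin) hu
  have hnull := ae_mem_weightedEllTwo (hw := hrow) (summable_absRowSum ha)
  exact invertibleModNull_of_bijOn (by fun_prop) measurableSet_weightedEllTwo hnull hnull hbij

end InvertibleModNull

section Banded

namespace IsBanded

variable {η : ℕ} {a : ℕ → ℕ → ℝ} (h_band : IsBanded η a)
include h_band

theorem support_subset (i : ℕ) :
    Function.support (a i) ⊆ Finset.Icc (i - η) (i + η) := fun j hj => by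
  have := mt (h_band i j) hj
  rw [Finset.coe_Icc, Set.mem_Icc]
  grind

theorem finite_support (i : ℕ) : (Function.support (a i)).Finite :=
  (Finset.finite_toSet _).subset (h_band.support_subset i)

variable {α : ℕ → ℝ} (h_bound : ∀ i j, |a i j| ≤ α i)
include h_bound

theorem absRowSum_le (i : ℕ) : absRowSum a i ≤ (2 * η + 1) * α i := by
  have hα : 0 ≤ α i := (abs_nonneg _).trans (h_bound i 0)
  have hcard : (Finset.Icc (i - η) (i + η)).card ≤ 2 * η + 1 := by
    rw [Nat.card_Icc]
    lia
  calc absRowSum a i = ∑ j ∈ Finset.Icc (i - η) (i + η), |a i j| :=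
        tsum_eq_sum fun j hj => by
          rw [abs_eq_zero, ← Function.notMem_support]
          exact fun hj' => hj (h_band.support_subset i hj')
    _ ≤ (Finset.Icc (i - η) (i + η)).card • α i :=
        Finset.sum_le_card_nsmul _ _ _ fun j _ => h_bound i j
    _ ≤ (2 * η + 1) * α i := by
        rw [nsmul_eq_mul]
        gcongr
        exact_mod_cast hcard

theorem summable_abs (hα : Summable α) : Summable fun q : ℕ × ℕ => |a q.1 q.2| :=
  (summable_prod_of_nonneg fun _ => abs_nonneg _).2
    ⟨fun i => summable_of_hasFiniteSupport <| (h_band.finite_support i).subset fun j => by simp,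
      (hα.mul_left (2 * η + 1 : ℝ)).of_nonneg_of_le (absRowSum_nonneg a)
        (h_band.absRowSum_le h_bound)⟩

end IsBanded

end Banded

theorem mainTheorem4_general {p : ℕ → ℝ} {a : ℕ → ℕ → ℝ}
    (h_fin : ∀ i, (Function.support (a i)).Finite)
    (ha : Summable fun q : ℕ × ℕ => |a q.1 q.2|) (h_symm : ∀ i j, a i j = a j i)
    {K : ℝ} (hK : 0 < K) (h_row : ∀ i, absRowSum a i ≤ K * p i) :
    ∃ (T : EllTwo →L[ℂ] EllTwo) (B : (ℕ → ℝ) → (ℕ → ℝ)),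
      InducesOperator a T ∧ InducesTransformation (onePlus a) B ∧
      IsTraceClass T ∧
      FredholmDetWellDefined T ∧
      (fredholmDet T ≠ 0 ↔ IsUnit (1 + T)) ∧
      (∃ C : ℝ, 0 < C ∧ ∀ x : ℕ → ℝ, Summable (fun j => x j ^ 2 * p j) →
        Summable (fun j => x j ^ 2 - B x j ^ 2) ∧
        |∑' j, (x j ^ 2 - B x j ^ 2)| ≤ C * ∑' j, x j ^ 2 * p j) ∧
      (fredholmDet T ≠ 0 → InvertibleModNull gaussianInf B) := by
  have hT := inducesOperator_matrixOperator ha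
  have hnuc := isNuclear_matrixOperator ha
  have hs := isSymmetric_matrixOperator ha h_symm
  have hB := hasSum_rowFiniteMap_apply a h_fin
  have hdet := hnuc.fredholmDet_ne_zero_iff hs
  have hS : 0 ≤ ∑' i, absRowSum a i := tsum_nonneg (absRowSum_nonneg a)
  refine ⟨matrixOperator a, fun x => x + rowFiniteMap a h_fin x, hT,
    fun x i => (hasSum_onePlus_mul (hB x i)).tendsto_sum_nat, hnuc.isTraceClass,
    hnuc.fredholmDetWellDefined hs, hdet,
    ⟨(2 + ∑' i, absRowSum a i) * K, by positivity, fun x hx => ?_⟩,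
    fun hne => invertibleModNull_id_add h_fin ha h_symm hT (hdet.1 hne)⟩
  exact summable_sq_sub_add_sq_and_abs_tsum_le_of_absRowSum_le ha h_symm (hB x) h_row hx

theorem mainTheorem4 (p α : ℕ → ℝ) (hp : ∀ j, 0 < p j) (hα : ∀ j, 0 < α j)
    (hp_sum : Summable p) (hα_sum : Summable α)
    (hp_ratio : ∃ m M : ℝ, 0 < m ∧ m < M ∧ ∀ j, p (j + 1) / p j ∈ Set.Ioo m M)
    (hαp : BddAbove (Set.range fun j => α j / p j))
    (η : ℕ) (bhat : ℕ → ℕ → ℝ) (h_band : IsBanded η bhat)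
    (h_bound : ∀ i j, |bhat i j| ≤ α i) (h_symm : ∀ i j, bhat i j = bhat j i) :
    ∃ (Bhat : EllTwo →L[ℂ] EllTwo) (B : (ℕ → ℝ) → (ℕ → ℝ)),
      InducesOperator bhat Bhat ∧ InducesTransformation (onePlus bhat) B ∧
      -- (1)
      IsTraceClass Bhat ∧
      -- (2)
      FredholmDetWellDefined Bhat ∧
      (fredholmDet Bhat ≠ 0 ↔ IsUnit (1 + Bhat)) ∧
      -- (3)
      (∃ C : ℝ, 0 < C ∧ ∀ x : ℕ → ℝ, Summable (fun j => x j ^ 2 * p j) →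
        Summable (fun j => x j ^ 2 - B x j ^ 2) ∧
        |∑' j, (x j ^ 2 - B x j ^ 2)| ≤ C * ∑' j, x j ^ 2 * p j) ∧
      -- (4)
      (fredholmDet Bhat ≠ 0 → InvertibleModNull gaussianInf B) := by
  obtain ⟨K, hK⟩ := hαp
  have hαK (i : ℕ) : α i ≤ K * p i := (div_le_iff₀ (hp i)).1 (hK ⟨i, rfl⟩)
  have hK0 : 0 < K := (div_pos (hα 0) (hp 0)).trans_le (hK ⟨0, rfl⟩)
  refine mainTheorem4_general h_band.finite_support (h_band.summable_abs h_bound hα_sum) h_symm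
    (K := (2 * η + 1) * K) (by positivity) fun i => ?_
  rw [mul_assoc]
  exact (h_band.absRowSum_le h_bound i).trans (by gcongr; exact hαK i)
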